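/- Let $\Bbbk$ be a field, $H$ a Hopf algebra over $\Bbbk$ with $\Delta(h)=\sum h_{(1)}\otimes h_{(2)}$, and $A$ an associative, not necessarily unital $\Bbbk$-algebra. Let $S=\{e_\lambda\}_{\lambda\in\Lambda}$ be a system of local units of $A$: each $e_\lambda$ is idempotent, and for every finite subset $F\subseteq A$ there is $\lambda\in\Lambda$ with $e_\lambda a=ae_\lambda=a$ for all $a\in F$. Let $\cdot:H\otimes A\to A$ be a symmetrical partial action, i.e. a linear map such that for all $h,l\in H$, $a,b\in A$, $$1_H\cdot a=a,\qquad h\cdot(a(l\cdot b))=\sum(h_{(1)}\cdot a)(h_{(2)}l\cdot b),\qquad h\cdot((l\cdot b)a)=\sum(h_{(1)}l\cdot b)(h_{(2)}\cdot a),$$ and suppose that it is $S$-categorizable: $H\cdot e_\lambda\subseteq e_\lambda Ae_\lambda$ for every $\lambda\in\Lambda$. The smash product $A\#H$ is the vector space $A\otimes H$ with the product $(a\#h)(b\#l)=\sum a(h_{(1)}\cdot b)\#h_{(2)}l$, and the partial smash product is its subalgebra $\underline{A\#H}=(A\#H)(A\#1_H)$. A unital module over a $\Bbbk$-algebra $R$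 is a $\Bbbk$-vector space $M$ with a $\Bbbk$-bilinear associative left action of $R$ such that $RM=M$; morphisms are the $\Bbbk$-linear maps commuting with the action. Let $\mathcal C=\mathcal C^S(A)$ be the $\Bbbk$-category with set of objects $\Lambda$, morphism spaces ${}_\beta\mathcal C_\alpha=\mathcal C(\alpha,\beta)=e_\beta Ae_\alpha$, and composition given by the multiplication of $A$. The action of $H$ on $A$ restricts to each $e_\beta Ae_\alpha$ and defines a partial action of $H$ on $\mathcal C$: that is, for composable morphisms $f:\alpha\to\beta$ and $g:\beta\to\gamma$ of $\mathcal C$ and $h,l\in H$, $$1_H\cdot f=f,\qquad h\cdot(g\circ f)=\sum(h_{(1)}\cdot g)\circ(h_{(2)}\cdot f),\qquad h\cdot(l\cdot f)=\sum(h_{(1)}\cdot 1_\beta)\circ(h_{(2)}l\cdot f).$$ The partial smash product $\underline{\mathcal C\#H}$ is the $\Bbbk$-category with the same objects as $\mathcal C$, with composition $(g\#h)\circ(f\#l)=\sum g\circ(h_{(1)}\cdot f)\#h_{(2)}l$, with morphism spaces $${}_\beta(\underline{\mathcal C\#H})_\alpha=({}_\beta\mathcal C_\alpha\otimes H)\circ({}_\alpha1_\alpha\#1_H)\subseteq{}_\beta\mathcal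 C_\alpha\otimes H,$$ and with identities ${}_\alpha1_\alpha\#1_H$. A module over a $\Bbbk$-category is a $\Bbbk$-linear functor from it to the category of $\Bbbk$-vector spaces, and morphisms of modules are natural transformations. Then the category of unital $\underline{A\#H}$-modules is equivalent to the category of $\underline{\mathcal C^S(A)\#H}$-modules. -/

import Mathlib

open scoped TensorProduct

universe v w uk uH uA

namespace PartialHopf

section Generic

variable {k H : Type*} [Field k] [Ring H] [HopfAlgebra k H]
variable {V₁ V₂ V₃ V₁₂ V₂₃ V : Type*}
  [AddCommGroup V₁] [Module k V₁] [AddCommGroup V₂] [Module k V₂] [AddCommGroup V₃] [Module k V₃]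
  [AddCommGroup V₁₂] [Module k V₁₂] [AddCommGroup V₂₃] [Module k V₂₃]
  [AddCommGroup V] [Module k V]

/-- `h ↦ ∑ m (F h₍₁₎) (G h₍₂₎)`, where `Δ h = ∑ h₍₁₎ ⊗ h₍₂₎`. -/
noncomputable def sweedler (m : V₁ →ₗ[k] V₂ →ₗ[k] V) (F : H →ₗ[k] V₁) (G : H →ₗ[k] V₂) :
    H →ₗ[k] V :=
  TensorProduct.lift m ∘ₗ TensorProduct.map F G ∘ₗ Coalgebra.comul

theorem sweedler_apply (m : V₁ →ₗ[k] V₂ →ₗ[k] V) (F : H →ₗ[k] V₁) (G : H →ₗ[k] V₂) {h : H}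
    {ι : Type*} (r : Coalgebra.Repr k h ι) :
    sweedler m F G h = ∑ i ∈ r.index, m (F (r.left i)) (G (r.right i)) := by
  simp [sweedler, ← r.eq]

/-- The product `(g # h) (f # l) = ∑ g (h₍₁₎ · f) # h₍₂₎ l`, for a bilinear product `m` and a linear
map `a : H ⊗ V₂ → V₂`, `h ⊗ f ↦ h · f`. -/
noncomputable def smashMul (m : V₁ →ₗ[k] V₂ →ₗ[k] V) (a : H →ₗ[k] V₂ →ₗ[k] V₂) :
    V₁ ⊗[k] H →ₗ[k] V₂ ⊗[k] H →ₗ[k] V ⊗[k] H :=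
  TensorProduct.lift (LinearMap.mk₂ k
    (fun g h => TensorProduct.homTensorHomMap (.id k) V₂ H V H
      (TensorProduct.map (a.compr₂ (m g)) (LinearMap.mul k H) (Coalgebra.comul h)))
    (fun g g' h => by
      have : a.compr₂ (m (g + g')) = a.compr₂ (m g) + a.compr₂ (m g') := by ext; simp
      rw [this, TensorProduct.map_add_left, LinearMap.add_apply, map_add])
    (fun c g h => by
      have : a.compr₂ (m (c • g)) = c • a.compr₂ (m g) := by ext; simp
      rw [this, TensorProduct.map_smul_left, LinearMap.smul_apply, map_smul])
    (fun g h h' => by simp)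
    (fun c g h => by simp))

theorem map_sweedler (m : V₁ →ₗ[k] V₂ →ₗ[k] V) (m' : V₁₂ →ₗ[k] V₂₃ →ₗ[k] V₃)
    (p₁ : V₁ →ₗ[k] V₁₂) (p₂ : V₂ →ₗ[k] V₂₃) (p : V →ₗ[k] V₃)
    (hp : ∀ g f, p (m g f) = m' (p₁ g) (p₂ f)) (F : H →ₗ[k] V₁) (G : H →ₗ[k] V₂) (h : H) :
    p (sweedler m F G h) = sweedler m' (p₁ ∘ₗ F) (p₂ ∘ₗ G) h := by
  rw [sweedler_apply _ _ _ (Coalgebra.Repr.arbitrary k h),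
    sweedler_apply _ _ _ (Coalgebra.Repr.arbitrary k h)]
  simp [hp]

theorem sweedler_assoc
    (m₁₂ : V₁ →ₗ[k] V₂ →ₗ[k] V₁₂) (m' : V₁₂ →ₗ[k] V₃ →ₗ[k] V)
    (m₂₃ : V₂ →ₗ[k] V₃ →ₗ[k] V₂₃) (m'' : V₁ →ₗ[k] V₂₃ →ₗ[k] V)
    (hm : ∀ g f e, m' (m₁₂ g f) e = m'' g (m₂₃ f e))
    (F : H →ₗ[k] V₁) (G : H →ₗ[k] V₂) (K : H →ₗ[k] V₃) :
    sweedler m' (sweedler m₁₂ F G) K = sweedler m'' F (sweedler m₂₃ G K) := by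
  ext h
  let r := Coalgebra.Repr.arbitrary k h
  let r₁ := fun i => Coalgebra.Repr.arbitrary k (r.left i)
  let r₂ := fun i => Coalgebra.Repr.arbitrary k (r.right i)
  rw [sweedler_apply _ _ _ r, sweedler_apply _ _ _ r]
  have L : ∀ i, sweedler m₁₂ F G (r.left i) =
      ∑ j ∈ (r₁ i).index, m₁₂ (F ((r₁ i).left j)) (G ((r₁ i).right j)) :=
    fun i => sweedler_apply _ _ _ (r₁ i)
  have R : ∀ i, sweedler m₂₃ G K (r.right i) =
      ∑ j ∈ (r₂ i).index, m₂₃ (G ((r₂ i).left j)) (K ((r₂ i).right j)) :=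
    fun i => sweedler_apply _ _ _ (r₂ i)
  simp only [L, R, map_sum, LinearMap.sum_apply, hm]
  have := congrArg (TensorProduct.lift (m''.compl₁₂ F
    (TensorProduct.lift (m₂₃.compl₁₂ G K)))) (Coalgebra.sum_tmul_tmul_eq r r₁ r₂)
  simpa [map_sum] using this

theorem smashMul_tmul (m : V₁ →ₗ[k] V₂ →ₗ[k] V) (a : H →ₗ[k] V₂ →ₗ[k] V₂) (g : V₁) {h : H}
    {ι : Type*} (r : Coalgebra.Repr k h ι) (f : V₂) (l : H) :
    smashMul m a (g ⊗ₜ h) (f ⊗ₜ l) =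
      ∑ i ∈ r.index, m g (a (r.left i) f) ⊗ₜ[k] (r.right i * l) := by
  simp [smashMul, ← r.eq]

theorem smashMul_tmul' (m : V₁ →ₗ[k] V₂ →ₗ[k] V) (a : H →ₗ[k] V₂ →ₗ[k] V₂) (g : V₁) (h : H)
    (f : V₂) (l : H) :
    smashMul m a (g ⊗ₜ h) (f ⊗ₜ l) =
      TensorProduct.map (m g ∘ₗ a.flip f) (LinearMap.mulRight k l) (Coalgebra.comul h) := by
  rw [smashMul_tmul m a g (Coalgebra.Repr.arbitrary k h)]
  conv_rhs => rw [← (Coalgebra.Repr.arbitrary k h).eq]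
  simp

theorem smashMul_assoc
    (m₁₂ : V₁ →ₗ[k] V₂ →ₗ[k] V₁₂) (m' : V₁₂ →ₗ[k] V₃ →ₗ[k] V)
    (m₂₃ : V₂ →ₗ[k] V₃ →ₗ[k] V₂₃) (m'' : V₁ →ₗ[k] V₂₃ →ₗ[k] V)
    (a₂ : H →ₗ[k] V₂ →ₗ[k] V₂) (a₃ : H →ₗ[k] V₃ →ₗ[k] V₃) (a₂₃ : H →ₗ[k] V₂₃ →ₗ[k] V₂₃)
    (hm : ∀ g f e, m' (m₁₂ g f) e = m'' g (m₂₃ f e))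
    (ha : ∀ h l f e, a₂₃ h (m₂₃ f (a₃ l e)) =
      sweedler m₂₃ (a₂.flip f) (a₃.flip e ∘ₗ LinearMap.mulRight k l) h)
    (x : V₁ ⊗[k] H) (y : V₂ ⊗[k] H) (z : V₃ ⊗[k] H) :
    smashMul m' a₃ (smashMul m₁₂ a₂ x y) z = smashMul m'' a₂₃ x (smashMul m₂₃ a₃ y z) := by
  induction x with
  | zero => simp
  | add x x' hx hx' => simp [hx, hx']
  | tmul g h =>
  induction y with
  | zero => simp
  | add y y' hy hy' => simp [hy, hy']
  | tmul f l =>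
  induction z with
  | zero => simp
  | add z z' hz hz' => simp [hz, hz']
  | tmul e p =>
  let r := Coalgebra.Repr.arbitrary k h
  let s := Coalgebra.Repr.arbitrary k l
  let r₁ := fun i => Coalgebra.Repr.arbitrary k (r.left i)
  let r₂ := fun i => Coalgebra.Repr.arbitrary k (r.right i)
  rw [smashMul_tmul _ _ _ r, smashMul_tmul _ _ _ s]
  simp only [map_sum, LinearMap.sum_apply]
  have key := Coalgebra.sum_tmul_tmul_eq r r₁ r₂
  have L : ∀ i, smashMul m' a₃ (m₁₂ g (a₂ (r.left i) f) ⊗ₜ (r.right i * l)) (e ⊗ₜ p) =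
      ∑ q ∈ s.index, ∑ j ∈ (r₂ i).index,
        m'' g (m₂₃ (a₂ (r.left i) f) (a₃ ((r₂ i).left j * s.left q) e)) ⊗ₜ[k]
          ((r₂ i).right j * (s.right q * p)) := by
    intro i
    rw [smashMul_tmul', Bialgebra.comul_mul, ← (r₂ i).eq, ← s.eq, Finset.sum_mul_sum, map_sum,
      Finset.sum_comm]
    simp [map_sum, hm, mul_assoc]
  have R : ∀ q, smashMul m'' a₂₃ (g ⊗ₜ h) (m₂₃ f (a₃ (s.left q) e) ⊗ₜ (s.right q * p)) =
      ∑ i ∈ r.index, ∑ j ∈ (r₁ i).index,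
        m'' g (m₂₃ (a₂ ((r₁ i).left j) f) (a₃ ((r₁ i).right j * s.left q) e)) ⊗ₜ[k]
          (r.right i * (s.right q * p)) := by
    intro q
    rw [smashMul_tmul _ _ _ r]
    refine Finset.sum_congr rfl fun i _ => ?_
    rw [ha, sweedler_apply _ _ _ (r₁ i)]
    simp [TensorProduct.sum_tmul]
  simp only [L, R]
  rw [Finset.sum_comm]
  refine Finset.sum_congr rfl fun q _ => ?_
  have := congrArg (TensorProduct.map
    (m'' g ∘ₗ TensorProduct.lift (m₂₃.compl₁₂ (a₂.flip f)
      (a₃.flip e ∘ₗ LinearMap.mulRight k (s.left q))))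
    (LinearMap.mulRight k (s.right q * p)) ∘ₗ (TensorProduct.assoc k H H H).symm.toLinearMap) key
  simpa [map_sum, mul_assoc] using this.symm

end Generic

section Algebras

variable (k H A : Type*) [Field k] [Ring H] [HopfAlgebra k H]
  [NonUnitalRing A] [Module k A] [IsScalarTower k A A] [SMulCommClass k A A]

/-- A partial action of a Hopf algebra `H` on an associative, not necessarily unital algebra `A`:
a linear map `H ⊗ A → A` with `1 · a = a` and `h · (a (l · b)) = ∑ (h₍₁₎ · a) (h₍₂₎ l · b)`. -/
structure PartialAction where
  act : H →ₗ[k] A →ₗ[k] A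
  one_act : ∀ a, act 1 a = a
  act_mul_act : ∀ (h l : H) (a b : A), act h (a * act l b) =
    sweedler (LinearMap.mul k A) (act.flip a) (act.flip b ∘ₗ LinearMap.mulRight k l) h

/-- A system of local units of `A`, indexed by `Λ` (repetitions are allowed). -/
structure LocalUnits (A Λ : Type*) [NonUnitalRing A] where
  e : Λ → A
  idem : ∀ i, e i * e i = e i
  exists_unit : ∀ F : Finset A, ∃ i, ∀ a ∈ F, e i * a = a ∧ a * e i = a

variable {k H A} {Λ : Type*}

namespace PartialAction

variable (α : PartialAction k H A)

/-- `h · ((l · b) a) = ∑ (h₍₁₎ l · b) (h₍₂₎ · a)`. -/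
def IsSymmetrical : Prop :=
  ∀ (h l : H) (a b : A), α.act h (α.act l b * a) =
    sweedler (LinearMap.mul k A) (α.act.flip b ∘ₗ LinearMap.mulRight k l) (α.act.flip a) h

/-- `H · eᵢ ⊆ eᵢ A eᵢ` for every local unit `eᵢ`. -/
def IsCategorizable (S : LocalUnits A Λ) : Prop :=
  ∀ (h : H) (i : Λ), ∃ a : A, α.act h (S.e i) = S.e i * a * S.e i

theorem act_mul (h : H) (a b : A) : α.act h (a * b) =
    sweedler (LinearMap.mul k A) (α.act.flip a) (α.act.flip b) h := by
  have := α.act_mul_act h 1 a b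
  rw [α.one_act] at this
  rw [this]
  congr 2
  ext; simp

/-- The smash product `A # H`: the vector space `A ⊗ H`, with the product
`(a # h) (b # l) = ∑ a (h₍₁₎ · b) # h₍₂₎ l`. -/
def Smash (_α : PartialAction k H A) : Type _ := A ⊗[k] H

noncomputable instance : AddCommGroup α.Smash := inferInstanceAs (AddCommGroup (A ⊗[k] H))

noncomputable instance : Module k α.Smash := inferInstanceAs (Module k (A ⊗[k] H))

noncomputable def Smash.mul : α.Smash →ₗ[k] α.Smash →ₗ[k] α.Smash :=
  smashMul (LinearMap.mul k A) α.act

noncomputable instance : NonUnitalRing α.Smash where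
  mul x y := Smash.mul α x y
  left_distrib x y z := map_add (Smash.mul α x) y z
  right_distrib x y z := LinearMap.map_add₂ (Smash.mul α) x y z
  zero_mul x := LinearMap.map_zero₂ (Smash.mul α) x
  mul_zero x := map_zero (Smash.mul α x)
  mul_assoc x y z := smashMul_assoc _ _ _ _ _ _ _ (fun g f e => mul_assoc g f e)
    (fun h l f e => α.act_mul_act h l f e) x y z

noncomputable instance : IsScalarTower k α.Smash α.Smash :=
  ⟨fun c x y => LinearMap.map_smul₂ (Smash.mul α) c x y⟩

noncomputable instance : SMulCommClass k α.Smash α.Smash :=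
  ⟨fun c x y => (map_smul (Smash.mul α x) c y).symm⟩

/-- The element `a # h`. -/
noncomputable def Smash.tmul (a : A) (h : H) : α.Smash := a ⊗ₜ[k] h

/-- The partial smash product `(A # H) (A # 1)`, the linear span of the products `x (b # 1)`. -/
noncomputable def partialSmash : NonUnitalSubalgebra k α.Smash where
  __ := Submodule.span k {z : α.Smash | ∃ (x : α.Smash) (b : A), x * Smash.tmul α b 1 = z}
  mul_mem' := by
    intro x y _ hy
    change x * y ∈ Submodule.span k _
    refine Submodule.span_induction (p := fun y _ => x * y ∈ Submodule.span k
      {z : α.Smash | ∃ (x : α.Smash) (b : A), x * Smash.tmul α b 1 = z}) ?_ ?_ ?_ ?_ hy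
    · rintro _ ⟨t, b, rfl⟩
      exact Submodule.subset_span ⟨x * t, b, mul_assoc _ _ _⟩
    · simp
    · intro s t _ _ hs ht
      rw [mul_add]
      exact add_mem hs ht
    · intro c t _ ht
      rw [mul_smul_comm]
      exact Submodule.smul_mem _ c ht

end PartialAction

end Algebras

section Modules

variable (k R : Type*) [Field k] [NonUnitalRing R] [Module k R]

/-- A unital left module over a not necessarily unital `k`-algebra `R`: a vector space `M` with a
bilinear associative action of `R` such that `R M = M`. -/
structure UnitalMod where
  carrier : Type v
  [addCommGroup : AddCommGroup carrier]
  [module : Module k carrier]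
  act : R →ₗ[k] carrier →ₗ[k] carrier
  mul_act : ∀ (r s : R) (m : carrier), act (r * s) m = act r (act s m)
  unital : Submodule.span k {m : carrier | ∃ (r : R) (n : carrier), act r n = m} = ⊤

attribute [instance] UnitalMod.addCommGroup UnitalMod.module

variable {k R}

/-- `R`-linear maps. -/
@[ext]
structure UnitalMod.Hom (M N : UnitalMod.{v} k R) where
  toLin : M.carrier →ₗ[k] N.carrier
  map_act : ∀ (r : R) (m : M.carrier), toLin (M.act r m) = N.act r (toLin m)

instance : CategoryTheory.Category (UnitalMod.{v} k R) where
  Hom M N := UnitalMod.Hom M N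
  id M := ⟨LinearMap.id, fun _ _ => rfl⟩
  comp f g := ⟨g.toLin ∘ₗ f.toLin, fun r m => by simp [f.map_act, g.map_act]⟩

end Modules

open CategoryTheory

section Categories

/-- The category of modules over a `k`-category `C`, that is of `k`-linear functors from `C` to
vector spaces. -/
abbrev CatMod (k C : Type*) [Field k] [Category C] [Preadditive C] [Linear k C] : Type _ :=
  ObjectProperty.FullSubcategory
    (fun F : C ⥤ ModuleCat.{v} k => F.Additive ∧ F.Linear k)

/-- Composition in the order `(g, f) ↦ g ∘ f`. -/
def compL (k : Type*) [Field k] {C : Type*} [Category C] [Preadditive C] [Linear k C]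
    (x y z : C) : (y ⟶ z) →ₗ[k] (x ⟶ y) →ₗ[k] (x ⟶ z) :=
  (Linear.comp x y z).flip

variable (k H C : Type*) [Field k] [Ring H] [HopfAlgebra k H]
  [Category C] [Preadditive C] [Linear k C]

/-- A partial action of a Hopf algebra `H` on a `k`-category `C`: linear maps
`H ⊗ C(x, y) → C(x, y)` with `1 · f = f`, `h · (g ∘ f) = ∑ (h₍₁₎ · g) ∘ (h₍₂₎ · f)` and
`h · (l · f) = ∑ (h₍₁₎ · id_y) ∘ (h₍₂₎ l · f)`. -/
structure CatPartialAction where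
  act : ∀ x y : C, H →ₗ[k] (x ⟶ y) →ₗ[k] (x ⟶ y)
  one_act : ∀ {x y : C} (f : x ⟶ y), act x y 1 f = f
  act_comp : ∀ (h : H) {x y z : C} (f : x ⟶ y) (g : y ⟶ z), act x z h (f ≫ g) =
    sweedler (compL k x y z) ((act y z).flip g) ((act x y).flip f) h
  act_act : ∀ (h l : H) {x y : C} (f : x ⟶ y), act x y h (act x y l f) =
    sweedler (compL k x y y) ((act y y).flip (𝟙 y))
      ((act x y).flip f ∘ₗ LinearMap.mulRight k l) h

variable {k H C}

namespace CatPartialAction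

variable (β : CatPartialAction k H C)

theorem act_comp_act (h l : H) {x y z : C} (f : y ⟶ z) (e : x ⟶ y) :
    β.act x z h (compL k x y z f (β.act x y l e)) =
      sweedler (compL k x y z) ((β.act y z).flip f)
        ((β.act x y).flip e ∘ₗ LinearMap.mulRight k l) h := by
  have h₁ : (β.act x y).flip (β.act x y l e) = sweedler (compL k x y y)
      ((β.act y y).flip (𝟙 y)) ((β.act x y).flip e ∘ₗ LinearMap.mulRight k l) := by
    ext h; exact β.act_act h l e
  have h₂ : (β.act y z).flip f = sweedler (compL k y y z)
      ((β.act y z).flip f) ((β.act y y).flip (𝟙 y)) := by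
    ext h
    have := β.act_comp h (𝟙 y) f
    rw [Category.id_comp] at this
    exact this
  refine (β.act_comp h (β.act x y l e) f).trans ?_
  rw [h₁, ← sweedler_assoc (compL k y y z) (compL k x y z) (compL k x y y) (compL k x y z)
    (fun g f e => (Category.assoc e f g).symm), ← h₂]

/-- The composition `(g # h) ∘ (f # l) = ∑ g ∘ (h₍₁₎ · f) # h₍₂₎ l` of the smash product `C # H`,
whose spaces of morphisms are the `C(x, y) ⊗ H`. -/
noncomputable def smashComp (x y z : C) :
    (y ⟶ z) ⊗[k] H →ₗ[k] (x ⟶ y) ⊗[k] H →ₗ[k] (x ⟶ z) ⊗[k] H :=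
  smashMul (compL k x y z) (β.act x y)

theorem smashComp_assoc {x y z t : C} (a : (z ⟶ t) ⊗[k] H) (b : (y ⟶ z) ⊗[k] H)
    (c : (x ⟶ y) ⊗[k] H) : β.smashComp x y t (β.smashComp y z t a b) c =
      β.smashComp x z t a (β.smashComp x y z b c) :=
  smashMul_assoc _ _ _ _ _ _ _ (fun g f e => (Category.assoc e f g).symm)
    (fun h l f e => β.act_comp_act h l f e) a b c

theorem one_smashComp {x y : C} (a : (x ⟶ y) ⊗[k] H) :
    β.smashComp x y y (𝟙 y ⊗ₜ 1) a = a := by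
  induction a with
  | zero => simp
  | add a b ha hb => rw [map_add, ha, hb]
  | tmul f l =>
    simp [smashComp, smashMul_tmul', compL, Linear.comp, β.one_act, Bialgebra.comul_one,
      Algebra.TensorProduct.one_def]

/-- The morphisms from `x` to `y` in the partial smash product: the space
`(C(x, y) ⊗ H) ∘ (id_x # 1)`. -/
noncomputable def smashHom (x y : C) : Submodule k ((x ⟶ y) ⊗[k] H) :=
  LinearMap.range ((β.smashComp x x y).flip (𝟙 x ⊗ₜ 1))

theorem smashComp_one {x y : C} {a : (x ⟶ y) ⊗[k] H} (ha : a ∈ β.smashHom x y) :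
    β.smashComp x x y a (𝟙 x ⊗ₜ 1) = a := by
  obtain ⟨b, rfl⟩ := ha
  rw [LinearMap.flip_apply, smashComp_assoc, one_smashComp]

/-- The partial smash product `k`-category of a partial action of `H` on `C`. It has the objects of
`C`, and its composition is that of `C # H`. -/
structure PartialSmash (β : CatPartialAction k H C) where
  obj : C

noncomputable instance : Category β.PartialSmash where
  Hom x y := β.smashHom x.obj y.obj
  id x := ⟨𝟙 x.obj ⊗ₜ 1, 𝟙 x.obj ⊗ₜ 1, β.one_smashComp _⟩
  comp {x y z} f g := ⟨β.smashComp x.obj y.obj z.obj g.1 f.1, by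
    obtain ⟨b, hb⟩ := f.2
    exact ⟨β.smashComp _ _ _ g.1 b, by
      rw [← hb, LinearMap.flip_apply, LinearMap.flip_apply, smashComp_assoc]⟩⟩
  id_comp f := Subtype.ext (β.smashComp_one f.2)
  comp_id f := Subtype.ext (β.one_smashComp f.1)
  assoc f g h := Subtype.ext (β.smashComp_assoc h.1 g.1 f.1).symm

noncomputable instance : Preadditive β.PartialSmash where
  homGroup x y := inferInstanceAs (AddCommGroup (β.smashHom x.obj y.obj))
  add_comp _ _ _ f f' g := Subtype.ext (map_add (β.smashComp _ _ _ g.1) f.1 f'.1)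
  comp_add _ _ _ f g g' := Subtype.ext
    (LinearMap.map_add₂ (β.smashComp _ _ _) g.1 g'.1 f.1)

noncomputable instance : Linear k β.PartialSmash where
  homModule x y := inferInstanceAs (Module k (β.smashHom x.obj y.obj))
  smul_comp _ _ _ c f g := Subtype.ext (map_smul (β.smashComp _ _ _ g.1) c f.1)
  comp_smul _ _ _ f c g := Subtype.ext
    (LinearMap.map_smul₂ (β.smashComp _ _ _) c g.1 f.1)

end CatPartialAction

end Categories

section LocalUnitsCategory

variable (k : Type*) {A Λ : Type*} [Field k] [NonUnitalRing A] [Module k A] [IsScalarTower k A A]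
  [SMulCommClass k A A]

namespace LocalUnits

variable (S : LocalUnits A Λ)

/-- The subspace `e_j A e_i` of `A`. -/
def corner (i j : Λ) : Submodule k A :=
  LinearMap.range (LinearMap.mulRight k (S.e i) ∘ₗ LinearMap.mulLeft k (S.e j))

theorem mem_corner {i j : Λ} {a : A} :
    a ∈ S.corner k i j ↔ S.e j * a = a ∧ a * S.e i = a := by
  constructor
  · rintro ⟨b, rfl⟩
    simp only [LinearMap.comp_apply, LinearMap.mulLeft_apply, LinearMap.mulRight_apply]
    exact ⟨by rw [← mul_assoc, ← mul_assoc, S.idem], by rw [mul_assoc, S.idem]⟩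
  · rintro ⟨h₁, h₂⟩
    exact ⟨a, by simp [h₁, h₂]⟩

/-- The `k`-category of a system of local units: its objects are the indices, the morphisms from
`i` to `j` are the elements of `e_j A e_i`, and `g ∘ f` is the product `g f` in `A`. -/
structure Cat (k : Type*) {A Λ : Type*} [NonUnitalRing A] (S : LocalUnits A Λ) where
  idx : Λ

variable {S k}

instance : Category (S.Cat k) where
  Hom x y := S.corner k x.idx y.idx
  id x := ⟨S.e x.idx, (S.mem_corner k).2 ⟨S.idem _, S.idem _⟩⟩
  comp f g := ⟨g.1 * f.1, (S.mem_corner k).2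
    ⟨by rw [← mul_assoc, ((S.mem_corner k).1 g.2).1],
      by rw [mul_assoc, ((S.mem_corner k).1 f.2).2]⟩⟩
  id_comp f := Subtype.ext ((S.mem_corner k).1 f.2).2
  comp_id f := Subtype.ext ((S.mem_corner k).1 f.2).1
  assoc f g h := Subtype.ext (mul_assoc h.1 g.1 f.1).symm

instance : Preadditive (S.Cat k) where
  homGroup x y := inferInstanceAs (AddCommGroup (S.corner k x.idx y.idx))
  add_comp _ _ _ f f' g := Subtype.ext (mul_add g.1 f.1 f'.1)
  comp_add _ _ _ f g g' := Subtype.ext (add_mul g.1 g'.1 f.1)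

instance : Linear k (S.Cat k) where
  homModule x y := inferInstanceAs (Module k (S.corner k x.idx y.idx))
  smul_comp _ _ _ c f g := Subtype.ext (mul_smul_comm c g.1 f.1)
  comp_smul _ _ _ f c g := Subtype.ext (smul_mul_assoc c g.1 f.1)

/-- The inclusion of `e_j A e_i` in `A`. -/
def Cat.incl (x y : S.Cat k) : (x ⟶ y) →ₗ[k] A := (S.corner k x.idx y.idx).subtype

end LocalUnits

variable {k} {H : Type*} [Ring H] [HopfAlgebra k H]

namespace PartialAction

variable (α : PartialAction k H A) {S : LocalUnits A Λ}

theorem act_mem_corner (hS : α.IsCategorizable S) (h : H) {i j : Λ} {a : A}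
    (ha : a ∈ S.corner k i j) : α.act h a ∈ S.corner k i j := by
  obtain ⟨h₁, h₂⟩ := (S.mem_corner k).1 ha
  refine (S.mem_corner k).2 ⟨?_, ?_⟩
  · rw [← h₁, act_mul, sweedler_apply _ _ _ (Coalgebra.Repr.arbitrary k h), Finset.mul_sum]
    refine Finset.sum_congr rfl fun p _ => ?_
    obtain ⟨b, hb⟩ := hS ((Coalgebra.Repr.arbitrary k h).left p) j
    simp only [LinearMap.flip_apply, LinearMap.mul_apply', hb, ← mul_assoc, S.idem]
  · rw [← h₂, act_mul, sweedler_apply _ _ _ (Coalgebra.Repr.arbitrary k h), Finset.sum_mul]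
    refine Finset.sum_congr rfl fun p _ => ?_
    obtain ⟨b, hb⟩ := hS ((Coalgebra.Repr.arbitrary k h).right p) i
    simp only [LinearMap.flip_apply, LinearMap.mul_apply', hb, mul_assoc, S.idem]

/-- The restriction of the action of `H` on `A` to the spaces `e_j A e_i`. -/
noncomputable def cornerAct (hS : α.IsCategorizable S) (x y : S.Cat k) :
    H →ₗ[k] (x ⟶ y) →ₗ[k] (x ⟶ y) :=
  LinearMap.mk₂ k
    (fun (h : H) (f : x ⟶ y) => (⟨α.act h f.1, α.act_mem_corner hS h f.2⟩ : x ⟶ y))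
    (fun h h' f => Subtype.ext (LinearMap.map_add₂ α.act h h' f.1))
    (fun c h f => Subtype.ext (LinearMap.map_smul₂ α.act c h f.1))
    (fun h f f' => Subtype.ext (map_add (α.act h) f.1 f'.1))
    (fun c h f => Subtype.ext (map_smul (α.act h) c f.1))

theorem incl_cornerAct (hS : α.IsCategorizable S) {x y : S.Cat k} (h : H) (f : x ⟶ y) :
    LocalUnits.Cat.incl x y (α.cornerAct hS x y h f) =
      α.act h (LocalUnits.Cat.incl x y f) := rfl

theorem incl_sweedler {x y z : S.Cat k} (F : H →ₗ[k] (y ⟶ z)) (G : H →ₗ[k] (x ⟶ y)) (h : H) :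
    LocalUnits.Cat.incl x z (sweedler (compL k x y z) F G h) =
      sweedler (LinearMap.mul k A) (LocalUnits.Cat.incl y z ∘ₗ F)
        (LocalUnits.Cat.incl x y ∘ₗ G) h :=
  map_sweedler _ _ _ _ _ (fun _ _ => rfl) F G h

/-- The partial action `h · (e_j a e_i)` of `H` on the `k`-category of the system of local units
`S`, induced by an `S`-categorizable partial action on `A`. -/
noncomputable def onCat (hS : α.IsCategorizable S) : CatPartialAction k H (S.Cat k) where
  act := α.cornerAct hS
  one_act f := Subtype.ext (α.one_act f.1)
  act_comp h x y z f g := by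
    refine Subtype.ext (Eq.trans (α.act_mul h g.1 f.1) ?_)
    refine Eq.trans ?_ (incl_sweedler _ _ h).symm
    congr 2
  act_act h l x y f := by
    have h₁ := ((S.mem_corner k).1 (α.act_mem_corner hS l f.2)).1
    have h₂ := α.act_mul_act h l (S.e y.idx) f.1
    rw [h₁] at h₂
    refine Subtype.ext (Eq.trans h₂ ?_)
    refine Eq.trans ?_ (incl_sweedler _ _ h).symm
    congr 2

end PartialAction

end LocalUnitsCategory

end PartialHopf

/-!
The elements `ε_i = e_i # 1` are local units of the partial smash product `R = (A # H) (A # 1)`: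
an element `∑ x (b # 1)` is fixed on the right by `ε_i` when `b e_i = b`, and on the left when `e_i`
fixes the first components of its tensors. The partial smash product category is the category of
the corners `ε_j R ε_i`. Indeed, the inclusion of `e_j A e_i ⊗ H` in `A ⊗ H` is injective since `k`
is a field, it turns composition into the product of `A # H`, and it maps `(e_j A e_i ⊗ H) (e_i # 1)`
onto `ε_j R ε_i` since `h · e_i` lies in `e_i A e_i` (`PartialAction.smashPresentation`).

The theorem then follows from a general fact on an algebra `R` with idempotent local units `ε_x`,
indexed by the objects of a `k`-category `C` whose spaces of morphisms are the corners `ε_y R ε_x`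
(`CornerPresentation.equivalence`): the functor that takes a unital `R`-module `M` to
`x ↦ ε_x M` is an equivalence.

* It is faithful and full because each vector of a unital module is fixed by a local unit: a natural
  transformation `η` comes from the map that takes `m` to the only `n` with `ε_x n = η_x (ε_x m)`
  for all `x` (`CornerPresentation.exists_of_natTrans`).
* It is essentially surjective because a module `M` embeds in `∏ x, ε_x M` by `m ↦ (ε_x m)_x`. The
  image consists of the families that are generated at some object `x`, that is `m_y = ε_y ε_x m_x`
  for all `y`. For a functor `F` on `C`, the families in `∏ x, F x` with `m_y = F (ε_y ε_x) m_x` for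
  some `x` and all `y` form a unital `R`-module (`CornerPresentation.glueMod`), and evaluation at `x`
  identifies its corner at `ε_x` with `F x` (`CornerPresentation.componentGlueIso`).
-/

namespace PartialHopf

open CategoryTheory

/-! ### Linear categories of corners -/

/-- A presentation of a `k`-category `C` as the category of corners of an algebra `R` with local
units: the objects `x` of `C` give idempotents `incl (𝟙 x)` that form a system of local units
of `R`, and `C(x, y)` is identified with the corner `incl (𝟙 y) * R * incl (𝟙 x)` in such a way that
composition is the product of `R`. -/
structure CornerPresentation (k R C : Type*) [Field k] [NonUnitalRing R] [Module k R]
    [Category C] [Preadditive C] [Linear k C] where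
  incl : ∀ x y : C, (x ⟶ y) →ₗ[k] R
  incl_injective : ∀ x y : C, Function.Injective (incl x y)
  incl_comp : ∀ {x y z : C} (f : x ⟶ y) (g : y ⟶ z), incl x z (f ≫ g) = incl y z g * incl x y f
  exists_incl_eq : ∀ (x y : C) (r : R), ∃ f : x ⟶ y,
    incl x y f = incl y y (𝟙 y) * r * incl x x (𝟙 x)
  exists_unit : ∀ F : Finset R, ∃ x : C, ∀ r ∈ F,
    incl x x (𝟙 x) * r = r ∧ r * incl x x (𝟙 x) = r

namespace CornerPresentation

variable {k R C : Type*} [Field k] [NonUnitalRing R] [Module k R]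
  [Category C] [Preadditive C] [Linear k C] (P : CornerPresentation k R C)

/-- The idempotent of `R` attached to an object. -/
def idem (x : C) : R := P.incl x x (𝟙 x)

@[simp]
theorem idem_mul_incl {x y : C} (f : x ⟶ y) : P.idem y * P.incl x y f = P.incl x y f := by
  rw [idem, ← P.incl_comp, Category.comp_id]

@[simp]
theorem incl_mul_idem {x y : C} (f : x ⟶ y) : P.incl x y f * P.idem x = P.incl x y f := by
  rw [idem, ← P.incl_comp, Category.id_comp]

@[simp]
theorem idem_mul_idem (x : C) : P.idem x * P.idem x = P.idem x := P.idem_mul_incl (𝟙 x)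

/-! ### From unital modules to functors -/

section Components

variable (M N : UnitalMod.{v} k R)

/-- By unitality, each vector is a sum `∑ rᵢ nᵢ`, and a common local unit of the `rᵢ` fixes it. -/
theorem exists_idem_act_eq (m : M.carrier) : ∃ x : C, M.act (P.idem x) m = m := by
  classical
  suffices h : ∃ F : Finset R, ∀ x : C, (∀ r ∈ F, P.idem x * r = r) → M.act (P.idem x) m = m by
    obtain ⟨F, hF⟩ := h
    obtain ⟨x, hx⟩ := P.exists_unit F
    exact ⟨x, hF x fun r hr => (hx r hr).1⟩
  have hm : m ∈ Submodule.span k {m | ∃ (r : R) (n : M.carrier), M.act r n = m} := by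
    rw [M.unital]; trivial
  induction hm using Submodule.span_induction with
  | mem m hm =>
    obtain ⟨r, n, rfl⟩ := hm
    exact ⟨{r}, fun x hx => by rw [← M.mul_act, hx r (by simp)]⟩
  | zero => exact ⟨∅, fun _ _ => map_zero _⟩
  | add m n _ _ hm hn =>
    obtain ⟨F, hF⟩ := hm
    obtain ⟨G, hG⟩ := hn
    refine ⟨F ∪ G, fun x hx => ?_⟩
    rw [map_add, hF x fun r hr => hx r (Finset.mem_union_left _ hr),
      hG x fun r hr => hx r (Finset.mem_union_right _ hr)]
  | smul c m _ hm =>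
    obtain ⟨F, hF⟩ := hm
    exact ⟨F, fun x hx => by rw [map_smul, hF x hx]⟩

theorem exists_mul_idem_eq (r : R) : ∃ x : C, r * P.idem x = r := by
  obtain ⟨x, hx⟩ := P.exists_unit {r}
  exact ⟨x, (hx r (by simp)).2⟩

/-- An object whose idempotent fixes `r` on the right. -/
noncomputable def rightUnit (r : R) : C := (P.exists_mul_idem_eq r).choose

theorem mul_idem_rightUnit (r : R) : r * P.idem (P.rightUnit r) = r :=
  (P.exists_mul_idem_eq r).choose_spec

theorem exists_idem_mul_eq (r : R) : ∃ x : C, P.idem x * r = r := by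
  obtain ⟨x, hx⟩ := P.exists_unit {r}
  exact ⟨x, (hx r (by simp)).1⟩

/-- Vectors of a unital module are separated by the action of the local units. -/
theorem ext_of_idem_act {m n : M.carrier}
    (h : ∀ x : C, M.act (P.idem x) m = M.act (P.idem x) n) : m = n := by
  rw [← sub_eq_zero]
  obtain ⟨x, hx⟩ := P.exists_idem_act_eq M (m - n)
  rw [← hx, map_sub, h, sub_self]

/-- The subspace `ε_x M`. -/
def component (x : C) : Submodule k M.carrier := LinearMap.range (M.act (P.idem x))

theorem mem_component {x : C} {m : M.carrier} :
    m ∈ P.component M x ↔ M.act (P.idem x) m = m := by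
  constructor
  · rintro ⟨n, rfl⟩
    rw [← M.mul_act, P.idem_mul_idem]
  · exact fun h => ⟨m, h⟩

/-- The action of a morphism `f : x ⟶ y` as a map `ε_x M → ε_y M`. -/
def componentMap {x y : C} (f : x ⟶ y) : P.component M x →ₗ[k] P.component M y :=
  (M.act (P.incl x y f)).restrict fun m _ => (P.mem_component M).2 (by
    rw [← M.mul_act, P.idem_mul_incl])

@[simp]
theorem coe_componentMap {x y : C} (f : x ⟶ y) (m : P.component M x) :
    (P.componentMap M f m : M.carrier) = M.act (P.incl x y f) m := rfl

/-- The functor `x ↦ ε_x M` of a unital module `M`. -/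
def componentFunctor : C ⥤ ModuleCat.{v} k where
  obj x := ModuleCat.of k (P.component M x)
  map f := ModuleCat.ofHom (P.componentMap M f)
  map_id _ := ModuleCat.hom_ext <| LinearMap.ext fun m =>
    Subtype.ext ((P.mem_component M).1 m.2)
  map_comp f g := ModuleCat.hom_ext <| LinearMap.ext fun m => Subtype.ext <|
    (congrArg (fun r => M.act r m.1) (P.incl_comp f g)).trans (M.mul_act _ _ _)

/-- The category module `x ↦ ε_x M` of a unital module `M`. -/
def componentMod : CatMod.{v} k C where
  obj := P.componentFunctor M
  property :=
    ⟨⟨fun {x y f g} => ModuleCat.hom_ext <| LinearMap.ext fun m => Subtype.ext <|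
        LinearMap.congr_fun ((congrArg M.act (map_add (P.incl x y) f g)).trans (map_add _ _ _)) m.1⟩,
      ⟨fun {x y} f c => ModuleCat.hom_ext <| LinearMap.ext fun m => Subtype.ext <|
        LinearMap.congr_fun
          ((congrArg M.act (map_smul (P.incl x y) c f)).trans (map_smul _ _ _)) m.1⟩⟩

variable {M N}

theorem map_mem_component (φ : M ⟶ N) {x : C} {m : M.carrier} (hm : m ∈ P.component M x) :
    UnitalMod.Hom.toLin φ m ∈ P.component N x := by
  rw [mem_component] at hm ⊢
  rw [← UnitalMod.Hom.map_act, hm]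

/-- The natural transformation given by the restrictions of `φ` to the subspaces `ε_x M`. -/
def componentNatTrans (φ : M ⟶ N) : P.componentFunctor M ⟶ P.componentFunctor N where
  app x := ModuleCat.ofHom ((UnitalMod.Hom.toLin φ).restrict
    fun _ hm => P.map_mem_component φ hm)
  naturality x y f := by
    ext m
    exact Subtype.ext (UnitalMod.Hom.map_act φ _ _)

/-- The functor from unital `R`-modules to `C`-modules that takes `M` to `x ↦ ε_x M`. -/
def toCatMod : UnitalMod.{v} k R ⥤ CatMod.{v} k C where
  obj M := P.componentMod M
  map φ := ObjectProperty.homMk (P.componentNatTrans φ)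
  map_id M := by ext x m; rfl
  map_comp φ ψ := by ext x m; rfl

/-- The map `ε_x M → ε_x N` of a natural transformation. -/
def natApp (η : P.componentFunctor M ⟶ P.componentFunctor N) (x : C) :
    P.component M x →ₗ[k] P.component N x := (η.app x).hom

theorem natApp_componentMap (η : P.componentFunctor M ⟶ P.componentFunctor N) {x y : C}
    (f : x ⟶ y) (m : P.component M x) :
    P.natApp η y (P.componentMap M f m) = P.componentMap N f (P.natApp η x m) :=
  LinearMap.congr_fun (congrArg ModuleCat.Hom.hom (η.naturality f)) m

/-- The projection `M → ε_x M`. -/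
def toComponent (M : UnitalMod.{v} k R) (x : C) : M.carrier →ₗ[k] P.component M x :=
  (M.act (P.idem x)).rangeRestrict

@[simp]
theorem coe_toComponent (x : C) (m : M.carrier) :
    (P.toComponent M x m : M.carrier) = M.act (P.idem x) m := rfl

instance : (P.toCatMod (C := C)).Faithful where
  map_injective {M N} φ ψ h := by
    refine UnitalMod.Hom.ext (LinearMap.ext fun m => ?_)
    obtain ⟨x, hx⟩ := P.exists_idem_act_eq M m
    have h' : P.componentNatTrans φ = P.componentNatTrans ψ :=
      congrArg (fun t => t.hom) h
    have := LinearMap.congr_fun (congrArg (fun η => P.natApp η x) h') ⟨m, (P.mem_component M).2 hx⟩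
    exact congrArg Subtype.val this

end Components

/-! ### Projections to corners -/

variable [IsScalarTower k R R] [SMulCommClass k R R]

/-- The projection `r ↦ ε_y r ε_x` of `R` to its corner `C(x, y)`. -/
noncomputable def cut (x y : C) : R →ₗ[k] (x ⟶ y) where
  toFun r := (P.exists_incl_eq x y r).choose
  map_add' r s := P.incl_injective x y <| by
    rw [map_add, (P.exists_incl_eq x y _).choose_spec, (P.exists_incl_eq x y _).choose_spec,
      (P.exists_incl_eq x y _).choose_spec, mul_add, add_mul]
  map_smul' c r := P.incl_injective x y <| by
    rw [map_smul, (P.exists_incl_eq x y _).choose_spec, (P.exists_incl_eq x y _).choose_spec,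
      RingHom.id_apply, mul_smul_comm, smul_mul_assoc]

@[simp]
theorem incl_cut (x y : C) (r : R) : P.incl x y (P.cut x y r) = P.idem y * r * P.idem x :=
  (P.exists_incl_eq x y r).choose_spec

@[simp]
theorem cut_incl {x y : C} (f : x ⟶ y) : P.cut x y (P.incl x y f) = f :=
  P.incl_injective x y (by simp)

theorem cut_idem (x : C) : P.cut x x (P.idem x) = 𝟙 x := P.cut_incl (𝟙 x)

/-- The corner elements `ε_z r ε_y` and `ε_y s ε_x` have product `ε_z t ε_x` as soon as
`r ε_y s ε_x = t ε_x`. -/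
theorem cut_comp_cut {x y z : C} (r s t : R) (h : r * P.idem y * s * P.idem x = t * P.idem x) :
    P.cut x y s ≫ P.cut y z r = P.cut x z t := by
  apply P.incl_injective
  have h' : P.idem z * (r * P.idem y * s * P.idem x) = P.idem z * (t * P.idem x) := by rw [h]
  rw [P.incl_comp, P.incl_cut, P.incl_cut, P.incl_cut]
  calc P.idem z * r * P.idem y * (P.idem y * s * P.idem x)
      = P.idem z * r * (P.idem y * P.idem y) * s * P.idem x := by simp only [mul_assoc]
    _ = P.idem z * (r * P.idem y * s * P.idem x) := by simp only [P.idem_mul_idem, mul_assoc]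
    _ = _ := by rw [h', mul_assoc]

/-! ### Fullness -/

/-- Naturality extends from morphisms of `C` to elements `r` of `R`: apply it to `ε_x r ε_z`. -/
theorem natApp_act {M N : UnitalMod.{v} k R}
    (η : P.componentFunctor M ⟶ P.componentFunctor N) (x z : C) (r : R)
    (hr : r * P.idem z = r) (m : M.carrier) :
    (P.natApp η x (P.toComponent M x (M.act r m)) : N.carrier) =
      N.act (P.idem x * r) (P.natApp η z (P.toComponent M z m)) := by
  have h := P.natApp_componentMap η (P.cut z x r) (P.toComponent M z m)
  have h₁ : P.componentMap M (P.cut z x r) (P.toComponent M z m) =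
      P.toComponent M x (M.act r m) := Subtype.ext (by
    simp [← M.mul_act, mul_assoc, hr])
  rw [h₁] at h
  rw [h, coe_componentMap, incl_cut, mul_assoc, hr]

/-- A natural transformation `η` comes from a map `M → N`: its value at `m` is the `n` with
`ε_x n = η_x (ε_x m)` for all `x`, which is unique by `ext_of_idem_act`. -/
theorem exists_of_natTrans {M N : UnitalMod.{v} k R}
    (η : P.componentFunctor M ⟶ P.componentFunctor N) (m : M.carrier) :
    ∃ n : N.carrier, ∀ x, N.act (P.idem x) n = P.natApp η x (P.toComponent M x m) := by
  obtain ⟨z, hz⟩ := P.exists_idem_act_eq M m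
  refine ⟨P.natApp η z (P.toComponent M z m), fun x => ?_⟩
  conv_rhs => rw [← hz]
  rw [P.natApp_act η x z _ (P.idem_mul_idem z), N.mul_act,
    (P.mem_component N).1 (P.natApp η z (P.toComponent M z m)).2]

instance : (P.toCatMod (C := C)).Full where
  map_surjective {M N} η := by
    let η' : P.componentFunctor M ⟶ P.componentFunctor N := η.hom
    choose φ hφ using P.exists_of_natTrans η'
    let Φ : UnitalMod.Hom M N :=
      { toLin :=
          { toFun := φ
            map_add' := fun m n => P.ext_of_idem_act N fun x => by simp [hφ]
            map_smul' := fun c m => P.ext_of_idem_act N fun x => by simp [hφ] }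
        map_act := fun r m => P.ext_of_idem_act N fun x => by
          obtain ⟨z, hz⟩ := P.exists_mul_idem_eq r
          change N.act (P.idem x) (φ (M.act r m)) = N.act (P.idem x) (N.act r (φ m))
          rw [hφ, P.natApp_act η' x z r hz, ← hφ, ← N.mul_act, ← N.mul_act, mul_assoc, hz] }
    refine ⟨Φ, ObjectProperty.hom_ext _ (NatTrans.ext (funext fun x => ModuleCat.hom_ext <|
      LinearMap.ext fun (m : P.component M x) => Subtype.ext ?_))⟩
    change φ m = (P.natApp η' x m : N.carrier)
    have hm : P.toComponent M x m = m := Subtype.ext ((P.mem_component M).1 m.2)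
    have h : φ m ∈ P.component N x := P.map_mem_component (M := M) (N := N) Φ m.2
    rw [← (P.mem_component N).1 h, hφ, hm]

/-! ### From functors to unital modules -/

section Glue

variable {P} (F : C ⥤ ModuleCat.{v} k)

/-- A family `m` is generated at `x` if `m y = F (ε_y ε_x) (m x)` for all `y`. -/
def IsGeneratedAt (P : CornerPresentation k R C) (m : ∀ x : C, F.obj x) (x : C) : Prop :=
  ∀ y, m y = F.map (P.cut x y (P.idem x)) (m x)

theorem map_cut_map_cut {x y z : C} {r s t : R} (h : r * P.idem y * s * P.idem x = t * P.idem x)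
    (m : F.obj x) :
    F.map (P.cut y z r) (F.map (P.cut x y s) m) = F.map (P.cut x z t) m := by
  rw [← P.cut_comp_cut r s t h, F.map_comp]
  rfl

variable {F}

namespace IsGeneratedAt

/-- The action of `r` on a generated family can be computed from its value at any `l` with
`r ε_l = r`, or from its value at an object that generates it. -/
theorem map_cut {m : ∀ x : C, F.obj x} {x : C} (hm : IsGeneratedAt F P m x) {l : C} {r : R}
    (hr : r * P.idem l = r) (y : C) : F.map (P.cut l y r) (m l) = F.map (P.cut x y r) (m x) := by
  rw [hm l]
  exact map_cut_map_cut F (by rw [hr, mul_assoc, P.idem_mul_idem]) _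

theorem of_idem_mul {m : ∀ x : C, F.obj x} {x z : C} (hm : IsGeneratedAt F P m x)
    (h : P.idem z * P.idem x = P.idem x) : IsGeneratedAt F P m z := fun y => by
  rw [hm z, hm y]
  exact (map_cut_map_cut F (by simp [h]) _).symm

/-- Local units make the objects directed, so that two generated families have a common generating
object. -/
theorem exists_common {m n : ∀ x : C, F.obj x} (hm : ∃ x, IsGeneratedAt F P m x)
    (hn : ∃ x, IsGeneratedAt F P n x) : ∃ x, IsGeneratedAt F P m x ∧ IsGeneratedAt F P n x := by
  classical
  obtain ⟨x, hx⟩ := hm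
  obtain ⟨y, hy⟩ := hn
  obtain ⟨z, hz⟩ := P.exists_unit {P.idem x, P.idem y}
  exact ⟨z, hx.of_idem_mul (hz _ (by simp)).1, hy.of_idem_mul (hz _ (by simp)).1⟩

end IsGeneratedAt

/-- The family `y ↦ F (ε_y r ε_x) a`, for `a` in `F x`. -/
noncomputable def family (P : CornerPresentation k R C) (F : C ⥤ ModuleCat.{v} k) {x : C} (r : R)
    (a : F.obj x) (y : C) : F.obj y := F.map (P.cut x y r) a

theorem isGeneratedAt_family {x z : C} {r : R} (h : P.idem z * r = r) (a : F.obj x) :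
    IsGeneratedAt F P (family P F r a) z := fun y =>
  (map_cut_map_cut F (by rw [P.idem_mul_idem, h]) a).symm

variable (P F)

/-- The space of the families in `∏ x, F x` that are generated at some object: the union of the
images of the embeddings `a ↦ (F (ε_y ε_x) a)_y` of the spaces `F x` in the product. -/
def glue : Submodule k (∀ x : C, F.obj x) where
  carrier := {m | ∃ x, IsGeneratedAt F P m x}
  zero_mem' := by
    obtain ⟨x, -⟩ := P.exists_unit ∅
    exact ⟨x, fun y => (map_zero (F.map _).hom).symm⟩
  add_mem' {m n} hm hn := by
    obtain ⟨x, hx, hy⟩ := IsGeneratedAt.exists_common hm hn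
    refine ⟨x, fun y => ?_⟩
    rw [Pi.add_apply, Pi.add_apply, hx y, hy y]
    exact (map_add (F.map _).hom _ _).symm
  smul_mem' c m hm := by
    obtain ⟨x, hx⟩ := hm
    refine ⟨x, fun y => ?_⟩
    rw [Pi.smul_apply, Pi.smul_apply, hx y]
    exact (map_smul (F.map _).hom _ _).symm

/-- The action `(r m) y = F (ε_y r ε_l) (m l)`, for a chosen `l` with `r ε_l = r`. By
`IsGeneratedAt.map_cut` the choice of `l` does not matter. -/
noncomputable def glueFun (r : R) (m : P.glue F) (y : C) : F.obj y :=
  F.map (P.cut (P.rightUnit r) y r) (m.1 (P.rightUnit r))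

variable {P F}

theorem glueFun_eq_family (r : R) {m : P.glue F} {x : C} (hm : IsGeneratedAt F P m.1 x) :
    P.glueFun F r m = family P F r (m.1 x) :=
  funext fun y => hm.map_cut (P.mul_idem_rightUnit r) y

theorem glueFun_mem (r : R) (m : P.glue F) : P.glueFun F r m ∈ P.glue F := by
  obtain ⟨x, hx⟩ := m.2
  obtain ⟨z, hz⟩ := P.exists_idem_mul_eq r
  rw [glueFun_eq_family r hx]
  exact ⟨z, isGeneratedAt_family hz _⟩

variable (P F)

/-- The action of `R` on the space of generated families. -/
noncomputable def glueAct [F.Additive] [F.Linear k] : R →ₗ[k] P.glue F →ₗ[k] P.glue F :=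
  LinearMap.mk₂ k (fun r m => ⟨P.glueFun F r m, glueFun_mem r m⟩)
    (fun r s m => Subtype.ext <| funext fun y => by
      obtain ⟨x, hx⟩ := m.2
      simp [glueFun_eq_family _ hx, family, F.map_add])
    (fun c r m => Subtype.ext <| funext fun y => by
      obtain ⟨x, hx⟩ := m.2
      simp [glueFun_eq_family _ hx, family, F.map_smul])
    (fun r m n => Subtype.ext <| funext fun y => map_add (F.map _).hom _ _)
    (fun c r m => Subtype.ext <| funext fun y => map_smul (F.map _).hom _ _)

variable [F.Additive] [F.Linear k]

variable {P F} in
theorem glueAct_apply (r : R) {m : P.glue F} {x : C} (hm : IsGeneratedAt F P m.1 x) (y : C) :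
    (P.glueAct F r m).1 y = F.map (P.cut x y r) (m.1 x) :=
  congrFun (glueFun_eq_family r hm) y

variable {P F} in
/-- The families generated at `x` are those in `ε_x M`, for `M` the module of generated families. -/
theorem glueAct_idem {m : P.glue F} {x : C} :
    P.glueAct F (P.idem x) m = m ↔ IsGeneratedAt F P m.1 x := by
  constructor
  · intro h
    obtain ⟨z, hz⟩ := m.2
    rw [← h]
    have : (P.glueAct F (P.idem x) m).1 = family P F (P.idem x) (m.1 z) := glueFun_eq_family _ hz
    rw [this]
    exact isGeneratedAt_family (P.idem_mul_idem x) _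
  · exact fun h => Subtype.ext <| funext fun y => (glueAct_apply _ h y).trans (h y).symm

end Glue

section EssSurj

variable {C : Type w} [Category C] [Preadditive C] [Linear k C] (P : CornerPresentation k R C)
  (F : C ⥤ ModuleCat.{max v w} k) [F.Additive] [F.Linear k]

/-- The unital module of generated families of a `C`-module. -/
noncomputable def glueMod : UnitalMod.{max v w} k R where
  carrier := P.glue F
  act := P.glueAct F
  mul_act r s m := Subtype.ext <| funext fun y => by
    obtain ⟨x, hx⟩ := m.2
    obtain ⟨z, hz⟩ := P.exists_idem_mul_eq s
    -- `s m` is generated at any `z` whose idempotent fixes `s` on the left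
    have hs : IsGeneratedAt F P (P.glueAct F s m).1 z := by
      change IsGeneratedAt F P (P.glueFun F s m) z
      rw [glueFun_eq_family s hx]
      exact isGeneratedAt_family hz _
    rw [glueAct_apply _ hx, glueAct_apply r hs, glueAct_apply s hx]
    exact (map_cut_map_cut F (by rw [mul_assoc r, hz]) _).symm
  unital := eq_top_iff.2 fun m _ => by
    obtain ⟨x, hx⟩ := m.2
    exact Submodule.subset_span ⟨P.idem x, m, glueAct_idem.2 hx⟩

/-- Evaluation of families at `x`, as a map `ε_x M → F x` for `M` the module of generated
families. -/
noncomputable def evalComponent (x : C) : P.component (P.glueMod F) x →ₗ[k] F.obj x :=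
  LinearMap.proj x ∘ₗ (P.glue F).subtype ∘ₗ (P.component (P.glueMod F) x).subtype

theorem isGeneratedAt_of_mem_component {x : C} {m : P.glue F}
    (hm : m ∈ P.component (P.glueMod F) x) : IsGeneratedAt F P m.1 x :=
  glueAct_idem.1 ((P.mem_component (P.glueMod F)).1 hm)

theorem evalComponent_bijective (x : C) : Function.Bijective (P.evalComponent F x) := by
  constructor
  · intro m n h
    have hm := P.isGeneratedAt_of_mem_component F m.2
    have hn := P.isGeneratedAt_of_mem_component F n.2
    have h' : m.1.1 x = n.1.1 x := h
    refine Subtype.ext (Subtype.ext (funext fun y => ?_))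
    rw [hm y, hn y, h']
  · intro a
    have h := isGeneratedAt_family (F := F) (P.idem_mul_idem x) a
    refine ⟨⟨⟨family P F (P.idem x) a, x, h⟩,
      (P.mem_component (P.glueMod F)).2 (glueAct_idem.2 h)⟩, ?_⟩
    change F.map (P.cut x x (P.idem x)) a = a
    rw [P.cut_idem, F.map_id]
    rfl

/-- A `C`-module is recovered from its generated families. -/
noncomputable def componentGlueIso : P.componentFunctor (P.glueMod F) ≅ F :=
  NatIso.ofComponents
    (fun x => (LinearEquiv.ofBijective _ (P.evalComponent_bijective F x)).toModuleIso)
    (fun {x y} f => ModuleCat.hom_ext <| LinearMap.ext fun m => by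
      have h := glueAct_apply (P.incl x y f) (P.isGeneratedAt_of_mem_component F m.2) y
      rw [P.cut_incl] at h
      exact h)

instance : (P.toCatMod : UnitalMod.{max v w} k R ⥤ CatMod.{max v w} k C).EssSurj where
  mem_essImage F := by
    have := F.property.1
    have := F.property.2
    exact ⟨P.glueMod F.obj, ⟨ObjectProperty.isoMk _ (P.componentGlueIso F.obj)⟩⟩

/-- Unital modules over `R` are the same as modules over its category of corners. -/
noncomputable def equivalence : UnitalMod.{max v w} k R ≌ CatMod.{max v w} k C :=
  have : P.toCatMod.IsEquivalence := { }
  P.toCatMod.asEquivalence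

end EssSurj

end CornerPresentation

/-! ### Corners of the partial smash product -/

namespace PartialAction

section Smash

variable {k H A Λ : Type*} [Field k] [Ring H] [HopfAlgebra k H]
  [NonUnitalRing A] [Module k A] [IsScalarTower k A A] [SMulCommClass k A A]
  (α : PartialAction k H A)

theorem Smash.tmul_one_mul_tmul (a b : A) (h : H) :
    Smash.tmul α a 1 * Smash.tmul α b h = Smash.tmul α (a * b) h := by
  refine (smashMul_tmul' (LinearMap.mul k A) α.act a 1 b h).trans ?_
  simp [Smash.tmul, Bialgebra.comul_one, Algebra.TensorProduct.one_def, α.one_act]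

theorem Smash.tmul_mul_tmul (a b : A) (h l : H) {ι : Type*} (r : Coalgebra.Repr k h ι) :
    Smash.tmul α a h * Smash.tmul α b l =
      ∑ i ∈ r.index, Smash.tmul α (a * α.act (r.left i) b) (r.right i * l) :=
  smashMul_tmul (LinearMap.mul k A) α.act a r b l

@[elab_as_elim]
theorem Smash.induction_on {p : α.Smash → Prop} (x : α.Smash) (zero : p 0)
    (tmul : ∀ a h, p (Smash.tmul α a h)) (add : ∀ x y, p x → p y → p (x + y)) : p x :=
  TensorProduct.induction_on x zero tmul add

variable (S : LocalUnits A Λ)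

/-- The element `e_i # 1`. -/
noncomputable def smashUnit (i : Λ) : α.Smash := Smash.tmul α (S.e i) 1

theorem mul_smashUnit_mem (x : α.Smash) (i : Λ) : x * α.smashUnit S i ∈ α.partialSmash :=
  Submodule.subset_span ⟨x, S.e i, rfl⟩

theorem exists_finset_smashUnit_mul (x : α.Smash) : ∃ T : Finset A, ∀ i,
    (∀ a ∈ T, S.e i * a = a) → α.smashUnit S i * x = x := by
  classical
  induction x using Smash.induction_on with
  | zero => exact ⟨∅, fun _ _ => mul_zero _⟩
  | tmul a h => exact ⟨{a}, fun i hi => by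
      rw [smashUnit, Smash.tmul_one_mul_tmul, hi a (by simp)]⟩
  | add x y hx hy =>
    obtain ⟨T, hT⟩ := hx
    obtain ⟨U, hU⟩ := hy
    refine ⟨T ∪ U, fun i hi => ?_⟩
    rw [mul_add, hT i fun a ha => hi a (Finset.mem_union_left _ ha),
      hU i fun a ha => hi a (Finset.mem_union_right _ ha)]

theorem exists_finset_mul_smashUnit {x : α.Smash} (hx : x ∈ α.partialSmash) :
    ∃ T : Finset A, ∀ i, (∀ a ∈ T, a * S.e i = a) → x * α.smashUnit S i = x := by
  classical
  induction hx using Submodule.span_induction with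
  | zero => exact ⟨∅, fun _ _ => zero_mul _⟩
  | mem x hx =>
    obtain ⟨x, b, rfl⟩ := hx
    exact ⟨{b}, fun i hi => by
      rw [mul_assoc, smashUnit, Smash.tmul_one_mul_tmul, hi b (by simp)]⟩
  | add x y _ _ hx hy =>
    obtain ⟨T, hT⟩ := hx
    obtain ⟨U, hU⟩ := hy
    refine ⟨T ∪ U, fun i hi => ?_⟩
    rw [add_mul, hT i fun a ha => hi a (Finset.mem_union_left _ ha),
      hU i fun a ha => hi a (Finset.mem_union_right _ ha)]
  | smul c x _ hx =>
    obtain ⟨T, hT⟩ := hx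
    exact ⟨T, fun i hi => by rw [smul_mul_assoc, hT i hi]⟩

/-- The elements `e_i # 1` are local units of the partial smash product. -/
theorem exists_smashUnit (F : Finset α.partialSmash) : ∃ i, ∀ x ∈ F,
    α.smashUnit S i * x = x ∧ (x : α.Smash) * α.smashUnit S i = x := by
  classical
  choose T hT using fun x : α.partialSmash => α.exists_finset_smashUnit_mul S x.1
  choose U hU using fun x : α.partialSmash => α.exists_finset_mul_smashUnit S x.2
  obtain ⟨i, hi⟩ := S.exists_unit (F.biUnion T ∪ F.biUnion U)
  refine ⟨i, fun x hx => ⟨hT x i fun a ha => (hi a ?_).1, hU x i fun a ha => (hi a ?_).2⟩⟩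
  · exact Finset.mem_union_left _ (Finset.mem_biUnion.2 ⟨x, hx, ha⟩)
  · exact Finset.mem_union_right _ (Finset.mem_biUnion.2 ⟨x, hx, ha⟩)

variable {S}

/-- The inclusion of `C(x, y) ⊗ H` in `A # H`. -/
noncomputable def tensorIncl (x y : S.Cat k) : (x ⟶ y) ⊗[k] H →ₗ[k] α.Smash :=
  (LocalUnits.Cat.incl x y).rTensor H

theorem tensorIncl_tmul {x y : S.Cat k} (f : x ⟶ y) (h : H) :
    α.tensorIncl x y (f ⊗ₜ h) = Smash.tmul α (LocalUnits.Cat.incl x y f) h := rfl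

theorem tensorIncl_injective (x y : S.Cat k) : Function.Injective (α.tensorIncl x y) :=
  Module.Flat.rTensor_preserves_injective_linearMap _ Subtype.val_injective

theorem tensorIncl_id (x : S.Cat k) : α.tensorIncl x x (𝟙 x ⊗ₜ 1) = α.smashUnit S x.idx := rfl

theorem tensorIncl_smashComp (hS : α.IsCategorizable S) {x y z : S.Cat k}
    (g : (y ⟶ z) ⊗[k] H) (f : (x ⟶ y) ⊗[k] H) :
    α.tensorIncl x z ((α.onCat hS).smashComp x y z g f) =
      α.tensorIncl y z g * α.tensorIncl x y f := by
  induction g with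
  | zero => rw [map_zero, map_zero, LinearMap.zero_apply, map_zero, zero_mul]
  | add g g' hg hg' => rw [map_add, map_add, LinearMap.add_apply, map_add, add_mul, hg, hg']
  | tmul g h =>
  induction f with
  | zero => rw [map_zero, map_zero, map_zero, mul_zero]
  | add f f' hf hf' => rw [map_add, map_add, map_add, mul_add, hf, hf']
  | tmul f l =>
  let r := Coalgebra.Repr.arbitrary k h
  rw [tensorIncl_tmul, tensorIncl_tmul, Smash.tmul_mul_tmul α _ _ _ _ r,
    CatPartialAction.smashComp, smashMul_tmul _ _ _ r, map_sum]
  rfl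

/-- The corner of the partial smash product at `e_x # 1` and `e_y # 1` is no larger than the image
of `C(x, y) ⊗ H` under right multiplication by `e_x # 1`. Categorizability is what makes this hold:
`(e_y a # h) (e_x # 1) = ∑ e_y a (h₍₁₎ · e_x) # h₍₂₎`, and `h₍₁₎ · e_x` begins with `e_x`. -/
theorem exists_tensorIncl_eq (hS : α.IsCategorizable S) (x y : S.Cat k) (s : α.Smash) :
    ∃ g : (x ⟶ y) ⊗[k] H, α.tensorIncl x y g * α.smashUnit S x.idx =
      α.smashUnit S y.idx * s * α.smashUnit S x.idx := by
  induction s using Smash.induction_on with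
  | zero => exact ⟨0, by rw [map_zero, mul_zero]⟩
  | add s t hs ht =>
    obtain ⟨g, hg⟩ := hs
    obtain ⟨g', hg'⟩ := ht
    exact ⟨g + g', by rw [map_add, add_mul, hg, hg', mul_add, add_mul]⟩
  | tmul a h =>
    let f : x ⟶ y := ⟨S.e y.idx * a * S.e x.idx, (S.mem_corner k).2
      ⟨by rw [← mul_assoc, ← mul_assoc, S.idem], by rw [mul_assoc, S.idem]⟩⟩
    refine ⟨f ⊗ₜ h, ?_⟩
    let r := Coalgebra.Repr.arbitrary k h
    rw [tensorIncl_tmul, smashUnit, smashUnit, Smash.tmul_one_mul_tmul,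
      Smash.tmul_mul_tmul α _ _ _ _ r, Smash.tmul_mul_tmul α _ _ _ _ r]
    refine Finset.sum_congr rfl fun i _ => ?_
    obtain ⟨b, hb⟩ := hS (r.left i) x.idx
    have : S.e y.idx * a * S.e x.idx * α.act (r.left i) (S.e x.idx) =
        S.e y.idx * a * α.act (r.left i) (S.e x.idx) := by
      rw [hb, mul_assoc _ (S.e x.idx), ← mul_assoc (S.e x.idx), ← mul_assoc (S.e x.idx), S.idem]
    exact congrArg (fun c => Smash.tmul α c (r.right i * 1)) this

theorem tensorIncl_mem (hS : α.IsCategorizable S) {x y : S.Cat k} {g : (x ⟶ y) ⊗[k] H}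
    (hg : g ∈ (α.onCat hS).smashHom x y) : α.tensorIncl x y g ∈ α.partialSmash := by
  obtain ⟨b, rfl⟩ := hg
  rw [LinearMap.flip_apply, tensorIncl_smashComp, tensorIncl_id]
  exact α.mul_smashUnit_mem S _ _

/-- The partial smash product category is the category of corners of the partial smash product at
the local units `e_i # 1`. -/
noncomputable def smashPresentation (hS : α.IsCategorizable S) :
    CornerPresentation k α.partialSmash (α.onCat hS).PartialSmash where
  incl x y := (α.tensorIncl x.obj y.obj).restrict
    (p := (α.onCat hS).smashHom x.obj y.obj) (q := α.partialSmash.toSubmodule)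
    fun _ hg => α.tensorIncl_mem hS hg
  incl_injective x y f g h := Subtype.ext <| α.tensorIncl_injective _ _ <|
    congrArg Subtype.val h
  incl_comp f g := Subtype.ext <| α.tensorIncl_smashComp hS g.1 f.1
  exists_incl_eq x y r := by
    obtain ⟨g, hg⟩ := α.exists_tensorIncl_eq hS x.obj y.obj r.1
    refine ⟨⟨(α.onCat hS).smashComp _ _ _ g (𝟙 x.obj ⊗ₜ 1), g, rfl⟩, Subtype.ext ?_⟩
    exact (α.tensorIncl_smashComp hS g (𝟙 x.obj ⊗ₜ 1)).trans hg
  exists_unit F := by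
    obtain ⟨i, hi⟩ := α.exists_smashUnit S F
    exact ⟨⟨⟨i⟩⟩, fun r hr => ⟨Subtype.ext (hi r hr).1, Subtype.ext (hi r hr).2⟩⟩

end Smash

end PartialAction

end PartialHopf

theorem mainTheorem11 {k : Type uk} [Field k] {H : Type uH} [Ring H]
    [HopfAlgebra k H] {A : Type uA} [NonUnitalRing A] [Module k A] [IsScalarTower k A A]
    [SMulCommClass k A A] {Λ : Type w} (S : PartialHopf.LocalUnits A Λ)
    (α : PartialHopf.PartialAction k H A) (hsymm : α.IsSymmetrical)
    (hcat : α.IsCategorizable S) :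
    Nonempty (CategoryTheory.Equivalence
      (PartialHopf.UnitalMod.{max v w} k α.partialSmash)
      (PartialHopf.CatMod.{max v w} k (α.onCat hcat).PartialSmash)) :=
  ⟨(α.smashPresentation hcat).equivalence⟩
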